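/- Let $\mathbb{F}_q$ be a finite field with $q$ elements and characteristic $p$, and let $\phi$ be the quadratic character of $\mathbb{F}_q^*$, extended by $\phi(0)=0$. Put $$\Sigma=\sum_{j,x\in\mathbb{F}_q^*}\phi(jx)\,\phi(1-x)\,\phi\bigl(x(j+1)^2+(j-1)^2\bigr).$$ (i) If $q\equiv 7\pmod 8$, then $\Sigma=2q$. (ii) If $q\equiv 3\pmod 8$, then there is a unique pair $(U,V)$ of positive integers with $p\nmid U$ and $q^2=U^2+2V^2$; there is a unique integer $u$ such that $q^2=u^2+2v^2$ for some integer $v$, $p\nmid u$ and $u\equiv -1\pmod 8$ (so $|u|=U$); and $\Sigma=2u$. (iii) In particular, if $q=p\equiv 3\pmod 8$, then there are integers $a_8,b_8$ with $p=a_8^2+2b_8^2$, and for any such integers $\Sigma=4a_8^2-2p$. -/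

import Mathlib

/-- The double character sum `∑_{j, x ∈ F^*} φ(jx) φ(1-x) φ(x(j+1)² + (j-1)²)` over a finite field,
where `φ` is the quadratic character, extended by `φ(0) = 0`. -/
def quadraticDoubleSum (F : Type*) [Field F] [Fintype F] [DecidableEq F] : ℤ :=
  ∑ j : Fˣ, ∑ x : Fˣ,
    quadraticChar F ((j : F) * (x : F)) * quadraticChar F (1 - (x : F)) *
      quadraticChar F ((x : F) * ((j : F) + 1) ^ 2 + ((j : F) - 1) ^ 2)

/-!
Let `q = #F ≡ 3 (mod 4)` and `K = F(i)`. The character sum `S = ∑ ψ(w) ψ(1 - w⁴)` over `K` of the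
curve `y² = w(1 - w⁴)` is computed in two ways.

Since the quadratic character `ψ` of `K` is `φ ∘ N`, the term of `S` at `w = a + bi` is a function
of `a²` and `b²`, and it is odd in this pair because `φ(-1) = -1`. The substitution `A = a²`,
`B = b²` therefore reduces `S` to a single twisted sum, which is `2Σ`.

For a character `χ` of order 8 of `K`, `S` is also the sum of the Jacobi sums `J(χᵏ, χ⁴)`,
`k = 1, 3, 5, 7`, and the Frobenius `y ↦ y ^ q` identifies those with indices `k` and `qk`. If
`q ≡ 7 (mod 8)`, it identifies complex conjugates, so each `J` is `±q` and `S ∈ {4q, 0, -4q}`. If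
`q ≡ 3 (mod 8)`, then `J(χ, χ⁴) = J(χ³, χ⁴)` lies in `ℤ[√-2]`, has norm `q²`, and its real part `U`
satisfies `S = 4U`.

Summing `S` along the powers of a generator of `Kˣ` gives `S / 4 ≡ -1 (mod 4)`, and the reduction
of `S` modulo `p` is a binomial coefficient, nonzero by the theorem of Lucas. These two facts single
out the value of `S`.
-/

open Finset

section QuadraticCharacterSums

variable {F : Type*} [Field F] [Fintype F] [DecidableEq F]

theorem sum_units_eq_sum {M : Type*} [AddCommMonoid M] (f : F → M) (h0 : f 0 = 0) :
    ∑ x : Fˣ, f x = ∑ x, f x := by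
  rw [Fintype.sum_eq_add_sum_subtype_ne f 0, h0, zero_add]
  exact unitsEquivNeZero.sum_comp fun x : {x : F // x ≠ 0} => f x

theorem sum_comp_sq (hF : ringChar F ≠ 2) {R : Type*} [CommRing R] (f : F → R) :
    ∑ a, f (a ^ 2) = ∑ A, ((quadraticChar F A : R) + 1) * f A := by
  rw [← sum_fiberwise univ (fun a : F => a ^ 2)]
  refine sum_congr rfl fun A _ => ?_
  have hcard := quadraticChar_card_sqrts hF A
  rw [Set.toFinset_ofFinset] at hcard
  rw [sum_congr rfl fun a ha => by rw [(mem_filter.mp ha).2], sum_const, nsmul_eq_mul]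
  exact_mod_cast congrArg (fun z : ℤ => (z : R) * f A) hcard

omit [DecidableEq F] in
theorem sum_sum_eq_zero_of_odd {Q : F → F → ℤ} (hQ : ∀ A B, Q (-A) (-B) = -Q A B) :
    ∑ A, ∑ B, Q A B = 0 := by
  refine self_eq_neg.mp ?_
  calc ∑ A, ∑ B, Q A B = ∑ A, ∑ B, Q (-A) (-B) := by
        rw [← Equiv.sum_comp (Equiv.neg F)]
        exact sum_congr rfl fun A _ => (Equiv.sum_comp (Equiv.neg F) _).symm
    _ = -∑ A, ∑ B, Q A B := by simp only [hQ, sum_neg_distrib]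

omit [DecidableEq F] in
theorem ringChar_ne_two_of_odd_card (h : Odd (Fintype.card F)) : ringChar F ≠ 2 := fun h2 =>
  Nat.not_even_iff_odd.mpr h <| Nat.even_iff.mpr <| FiniteField.even_card_of_char_two h2

theorem quadraticChar_neg_of_card_mod_four (h : Fintype.card F % 4 = 3) (a : F) :
    quadraticChar F (-a) = -quadraticChar F a := by
  have h1 : quadraticChar F (-1) = -1 := by
    rw [quadraticChar_neg_one_iff_not_isSquare, FiniteField.isSquare_neg_one_iff]
    exact not_not.mpr h
  rw [← neg_one_mul, map_mul, h1, neg_one_mul]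

theorem sum_sum_comp_sq_of_odd (h : Fintype.card F % 4 = 3) {P : F → F → ℤ}
    (hsymm : ∀ A B, P A B = P B A) (hodd : ∀ A B, P (-A) (-B) = -P A B) :
    ∑ a, ∑ b, P (a ^ 2) (b ^ 2) = 2 * ∑ A, ∑ B, quadraticChar F A * P A B := by
  have hF : ringChar F ≠ 2 := ringChar_ne_two_of_odd_card (Nat.odd_iff.mpr (by omega))
  have hexpand : ∑ a, ∑ b, P (a ^ 2) (b ^ 2) =
      ∑ A, ∑ B, (P A B + quadraticChar F A * quadraticChar F B * P A B +
        (quadraticChar F A * P A B + quadraticChar F B * P A B)) := by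
    simp_rw [fun a => sum_comp_sq hF (P (a ^ 2)), Int.cast_id]
    rw [sum_comp_sq hF fun A => ∑ B, (quadraticChar F B + 1) * P A B]
    simp_rw [mul_sum, Int.cast_id]
    exact sum_congr rfl fun A _ => sum_congr rfl fun B _ => by ring
  have hmixed : ∑ A, ∑ B, quadraticChar F B * P A B = ∑ A, ∑ B, quadraticChar F A * P A B := by
    rw [sum_comm]
    simp_rw [hsymm]
  have hψψ : ∑ A, ∑ B, quadraticChar F A * quadraticChar F B * P A B = 0 :=
    sum_sum_eq_zero_of_odd fun A B => by
      simp only [quadraticChar_neg_of_card_mod_four h, hodd]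
      ring
  simp only [hexpand, sum_add_distrib, sum_sum_eq_zero_of_odd hodd, hψψ, hmixed]
  ring

theorem sum_quadraticChar_mul_neg_mul_add (hF : ringChar F ≠ 2) (d : F) :
    ∑ x, quadraticChar F x * quadraticChar F (-x) * quadraticChar F (x + d) =
      -quadraticChar F (-1) * quadraticChar F d := by
  have hterm (x : F) : quadraticChar F x * quadraticChar F (-x) * quadraticChar F (x + d) =
      quadraticChar F (-1) *
        (quadraticChar F (x + d) - if x = 0 then quadraticChar F d else 0) := by
    rw [← neg_one_mul x, map_mul]
    split_ifs with hx
    · simp [hx]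
    · linear_combination
        quadraticChar F (-1) * quadraticChar F (x + d) * quadraticChar_sq_one hx
  have hshift : ∑ x, quadraticChar F (x + d) = 0 :=
    (Equiv.sum_comp (Equiv.addRight d) (quadraticChar F ·)).trans (quadraticChar_sum_zero hF)
  simp_rw [hterm, ← mul_sum, sum_sub_distrib, hshift, sum_ite_eq', mem_univ, if_true]
  ring

theorem sum_quadraticChar_mul_one_sub (hF : ringChar F ≠ 2) :
    ∑ x, quadraticChar F x * quadraticChar F (1 - x) = -quadraticChar F (-1) := by
  have h := jacobiSum_nontrivial_inv (quadraticChar_ne_one hF)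
  rwa [(quadraticChar_isQuadratic F).inv] at h

theorem sum_quadraticChar_mul_sq_sub_mul_add (hF : ringChar F ≠ 2) (d e : F) :
    ∑ x, quadraticChar F x * quadraticChar F (e ^ 2 - x) * quadraticChar F (x + d) =
      ∑ x, quadraticChar F x * quadraticChar F (1 - x) * quadraticChar F (e ^ 2 * x + d) := by
  rcases eq_or_ne e 0 with rfl | he
  · simp only [zero_pow two_ne_zero, zero_sub, zero_mul, zero_add, ← sum_mul,
      sum_quadraticChar_mul_neg_mul_add hF, sum_quadraticChar_mul_one_sub hF]
  · rw [← Equiv.sum_comp (Equiv.mulLeft₀ _ (pow_ne_zero 2 he))]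
    refine sum_congr rfl fun x _ => ?_
    have hfactor : e ^ 2 - e ^ 2 * x = e ^ 2 * (1 - x) := by ring
    simp only [Equiv.mulLeft₀_apply, hfactor, map_mul (quadraticChar F) (e ^ 2),
      quadraticChar_sq_one' he, one_mul]

theorem sum_quadraticChar_kernel (hF : ringChar F ≠ 2) (r : F) :
    ∑ A, quadraticChar F A * quadraticChar F ((r ^ 2 + 1) ^ 2 - 4 * (2 * A - r) ^ 2) =
      ∑ x, quadraticChar F x * quadraticChar F (1 - x) *
        quadraticChar F (x * (r + 1) ^ 2 + (r - 1) ^ 2) := by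
  have h2 : (2 : F) ≠ 0 := Ring.two_ne_zero hF
  have h4 : (2 ^ 2 : F) ≠ 0 := pow_ne_zero 2 h2
  have hfactor (A : F) : (r ^ 2 + 1) ^ 2 - 4 * (2 * A - r) ^ 2 =
      (2 ^ 2) ^ 2 * (((r + 1) / 2) ^ 2 - A) * (A + ((r - 1) / 2) ^ 2) := by
    field_simp
    ring
  have hscale (x : F) : x * (r + 1) ^ 2 + (r - 1) ^ 2 =
      2 ^ 2 * (((r + 1) / 2) ^ 2 * x + ((r - 1) / 2) ^ 2) := by
    field_simp
  simp only [hfactor, hscale, map_mul, quadraticChar_sq_one' h2, quadraticChar_sq_one' h4, one_mul]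
  simpa only [mul_assoc] using
    sum_quadraticChar_mul_sq_sub_mul_add hF (((r - 1) / 2) ^ 2) ((r + 1) / 2)

theorem sum_kernel_eq_two_mul_quadraticDoubleSum (h : Fintype.card F % 4 = 3) :
    ∑ a : F, ∑ b : F, quadraticChar F (a ^ 2 + b ^ 2) *
        quadraticChar F (((a ^ 2 + b ^ 2) ^ 2 + 1) ^ 2 - 4 * (a ^ 2 - b ^ 2) ^ 2) =
      2 * quadraticDoubleSum F := by
  have hF : ringChar F ≠ 2 := ringChar_ne_two_of_odd_card (Nat.odd_iff.mpr (by omega))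
  let P (A B : F) : ℤ := quadraticChar F (A + B) *
    quadraticChar F (((A + B) ^ 2 + 1) ^ 2 - 4 * (A - B) ^ 2)
  have hsymm (A B : F) : P A B = P B A := by
    simp only [P, add_comm A B, ← neg_sub B A, neg_sq]
  have hodd (A B : F) : P (-A) (-B) = -P A B := by
    simp only [P, ← neg_add, neg_sub_neg, neg_sq, quadraticChar_neg_of_card_mod_four h, neg_mul,
      ← neg_sub A B]
  rw [sum_sum_comp_sq_of_odd h hsymm hodd]
  congr 1
  calc ∑ A, ∑ B, quadraticChar F A * P A B
      = ∑ A, ∑ r, quadraticChar F A * P A (r - A) :=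
        sum_congr rfl fun A _ => (Equiv.sum_comp (Equiv.subRight A) _).symm
    _ = ∑ r, quadraticChar F r * ∑ A, quadraticChar F A *
          quadraticChar F ((r ^ 2 + 1) ^ 2 - 4 * (2 * A - r) ^ 2) := by
        rw [sum_comm]
        simp_rw [mul_sum]
        refine sum_congr rfl fun r _ => sum_congr rfl fun A _ => ?_
        simp only [P, add_sub_cancel, show A - (r - A) = 2 * A - r by ring]
        ring
    _ = quadraticDoubleSum F := by
        simp_rw [sum_quadraticChar_kernel hF, mul_sum]
        rw [quadraticDoubleSum, ← sum_units_eq_sum _ (by simp)]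
        refine sum_congr rfl fun j _ => ?_
        rw [← sum_units_eq_sum _ (by simp)]
        simp only [map_mul, mul_assoc]

end QuadraticCharacterSums

section Norm

theorem quadraticChar_eq_quadraticChar_norm {F K : Type*} [Field F] [Fintype F] [DecidableEq F]
    [Field K] [Fintype K] [DecidableEq K] [Algebra F K] (hF : ringChar F ≠ 2) (w : K) :
    quadraticChar K w = quadraticChar F (Algebra.norm F w) := by
  have hK : ringChar K ≠ 2 := by rwa [← Algebra.ringChar_eq F K]
  refine (quadraticChar_isQuadratic K).eq_of_eq_coe (quadraticChar_isQuadratic F) hK ?_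
  have hexp : Fintype.card K / 2 =
      (Fintype.card K - 1) / (Fintype.card F - 1) * (Fintype.card F / 2) := by
    have hdvd : Fintype.card F - 1 ∣ Fintype.card K - 1 := by
      rw [Module.card_eq_pow_finrank (K := F) (V := K)]
      simpa using Nat.sub_dvd_pow_sub_pow (Fintype.card F) 1 (Module.finrank F K)
    obtain ⟨t, ht⟩ := hdvd
    have hcardF := FiniteField.odd_card_of_char_ne_two hF
    have hone : 1 < Fintype.card F := Fintype.one_lt_card
    have hone' : 1 < Fintype.card K := Fintype.one_lt_card
    have hhalf : Fintype.card F - 1 = 2 * (Fintype.card F / 2) := by omega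
    rw [ht, Nat.mul_div_cancel_left t (by omega)]
    rw [hhalf, mul_assoc, mul_comm (_ / 2) t] at ht
    omega
  rw [quadraticChar_eq_pow_of_char_ne_two' hK, ← map_intCast (algebraMap F K),
    quadraticChar_eq_pow_of_char_ne_two' hF, map_pow, FiniteField.algebraMap_norm_eq_pow,
    ← pow_mul, Nat.card_eq_fintype_card, Nat.card_eq_fintype_card, hexp]

/-- The character sum of the genus two curve `y² = w(1 - w⁴)`, which has
`Fintype.card K + quinticCharSum K` affine points over `K` in odd characteristic. -/
def quinticCharSum (K : Type*) [Field K] [Fintype K] [DecidableEq K] : ℤ :=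
  ∑ w : K, quadraticChar K w * quadraticChar K (1 - w ^ 4)

/-- The algebra `F(i) = F[X]/(X² + 1)`, a quadratic field extension of `F` when `-1` is not a
square. -/
abbrev GaussExt (F : Type*) [Field F] := QuadraticAlgebra F (-1 : F) 0

namespace GaussExt

variable (F : Type*) [Field F] [Fintype F]

instance : Fintype (GaussExt F) :=
  Fintype.ofEquiv (F × F) (QuadraticAlgebra.equivProd (-1 : F) 0).symm

theorem card_eq_sq : Fintype.card (GaussExt F) = Fintype.card F ^ 2 := by
  rw [Fintype.card_congr (QuadraticAlgebra.equivProd (-1 : F) 0), Fintype.card_prod, sq]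

variable {F}

theorem fact_of_card_mod_four (h : Fintype.card F % 4 = 3) :
    Fact (∀ r : F, r ^ 2 ≠ (-1 : F) + 0 * r) := by
  refine ⟨fun r hr => FiniteField.isSquare_neg_one_iff.mp ⟨r, ?_⟩ h⟩
  rw [← sq, hr, zero_mul, add_zero]

omit [Fintype F] in
theorem algebra_norm_eq [Fact (∀ r : F, r ^ 2 ≠ (-1 : F) + 0 * r)] (w : GaussExt F) :
    Algebra.norm F w = w.re ^ 2 + w.im ^ 2 := by
  rw [Algebra.norm_apply]
  refine (QuadraticAlgebra.det_toLinearMap_eq_norm w).trans ?_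
  rw [QuadraticAlgebra.norm_def]
  ring

theorem quinticCharSum_eq_two_mul_quadraticDoubleSum [DecidableEq F] [DecidableEq (GaussExt F)]
    [Fact (∀ r : F, r ^ 2 ≠ (-1 : F) + 0 * r)] (h : Fintype.card F % 4 = 3) :
    quinticCharSum (GaussExt F) = 2 * quadraticDoubleSum F := by
  have hF : ringChar F ≠ 2 := ringChar_ne_two_of_odd_card (Nat.odd_iff.mpr (by omega))
  rw [← sum_kernel_eq_two_mul_quadraticDoubleSum h, ← Fintype.sum_prod_type',
    ← Equiv.sum_comp (QuadraticAlgebra.equivProd (-1 : F) 0), quinticCharSum]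
  refine sum_congr rfl fun w _ => ?_
  rw [quadraticChar_eq_quadraticChar_norm hF w, algebra_norm_eq,
    quadraticChar_eq_quadraticChar_norm hF (1 - w ^ 4), algebra_norm_eq]
  congr 2
  simp only [QuadraticAlgebra.equivProd, Equiv.coe_fn_mk, pow_succ, pow_zero, one_mul,
    QuadraticAlgebra.re_sub, QuadraticAlgebra.im_sub, QuadraticAlgebra.re_one,
    QuadraticAlgebra.im_one, QuadraticAlgebra.re_mul, QuadraticAlgebra.im_mul]
  ring

end GaussExt

end Norm

section JacobiSums

variable {K : Type*} [Field K] [Fintype K]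

theorem quadraticChar_generator [DecidableEq K] (hK : ringChar K ≠ 2) {g : Kˣ}
    (hg : ∀ x, x ∈ Subgroup.zpowers g) : quadraticChar K g = -1 := by
  refine (quadraticChar_dichotomy g.ne_zero).resolve_left fun hg1 => quadraticChar_ne_one hK ?_
  exact (MulChar.eq_iff hg _ _).mpr (by rw [hg1, MulChar.one_apply_coe])

theorem eq_quadraticChar_of_orderOf_eq_two [DecidableEq K] {R : Type*} [CommRing R] [IsDomain R]
    (hK : ringChar K ≠ 2) {ψ : MulChar K R} (hψ : orderOf ψ = 2) (w : K) :
    ψ w = quadraticChar K w := by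
  obtain ⟨g, hg⟩ := IsCyclic.exists_generator (α := Kˣ)
  have hsq : ψ g ^ 2 = 1 := by
    rw [← MulChar.pow_apply_coe, ← hψ, pow_orderOf_eq_one, MulChar.one_apply_coe]
  have hne : ψ g ≠ 1 := fun hg1 => by
    have hψ1 : ψ = 1 := (MulChar.eq_iff hg _ _).mpr (by rw [hg1, MulChar.one_apply_coe])
    rw [hψ1, orderOf_one] at hψ
    omega
  have hψφ : ψ = (quadraticChar K).ringHomComp (Int.castRingHom R) := by
    refine (MulChar.eq_iff hg _ _).mpr ?_
    rw [(sq_eq_one_iff.mp hsq).resolve_left hne, MulChar.ringHomComp_apply,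
      quadraticChar_generator hK hg, map_neg, map_one]
  exact congrArg (· w) (congrArg DFunLike.coe hψφ)

theorem sum_comp_pow_four {R : Type*} [CommRing R] [IsDomain R] (hK : ringChar K ≠ 2)
    {θ : MulChar K R} (hθ : orderOf θ = 4) (f : K → R) :
    ∑ w, f (w ^ 4) = ∑ y, (1 + θ y + θ y ^ 2 + θ y ^ 3) * f y := by
  classical
  have hquad (y : K) : (quadraticChar K y : R) = θ y ^ 2 := by
    have hθ2 : orderOf (θ ^ 2) = 2 := by rw [orderOf_pow_of_dvd two_ne_zero] <;> simp [hθ]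
    rw [← MulChar.pow_apply' θ two_ne_zero, eq_quadraticChar_of_orderOf_eq_two hK hθ2]
  calc ∑ w, f (w ^ 4) = ∑ w : K, f ((w ^ 2) ^ 2) := by simp only [← pow_mul]
    _ = ∑ z, (θ (z ^ 2) + 1) * f (z ^ 2) := by
        rw [sum_comp_sq hK fun z => f (z ^ 2)]
        simp only [hquad, map_pow]
    _ = ∑ y, (1 + θ y + θ y ^ 2 + θ y ^ 3) * f y := by
        rw [sum_comp_sq hK fun y => (θ y + 1) * f y]
        exact sum_congr rfl fun y _ => by rw [hquad]; ring

theorem jacobiSum_pow_card {R : Type*} [CommRing R] (F : Type*) [Field F] [Fintype F] [Algebra F K]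
    (χ ψ : MulChar K R) :
    jacobiSum (χ ^ Fintype.card F) (ψ ^ Fintype.card F) = jacobiSum χ ψ := by
  have hcard : Fintype.card F ≠ 0 := Fintype.card_ne_zero
  let σ := FiniteField.frobeniusAlgEquivOfAlgebraic F K
  have hσ (y : K) : σ y = y ^ Fintype.card F := rfl
  have hσ' (y : K) : 1 - σ y = (1 - y) ^ Fintype.card F := by rw [← hσ, map_sub, map_one]
  calc jacobiSum (χ ^ Fintype.card F) (ψ ^ Fintype.card F) = ∑ y, χ (σ y) * ψ (1 - σ y) := by
        simp only [jacobiSum, hσ']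
        simp only [hσ, map_pow, MulChar.pow_apply' _ hcard]
    _ = jacobiSum χ ψ := Equiv.sum_comp σ.toEquiv fun y => χ y * ψ (1 - y)

theorem jacobiSum_pow_eq_of_modEq {R : Type*} [CommRing R] (F : Type*) [Field F] [Fintype F]
    [Algebra F K] {χ : MulChar K R} {k l m n : ℕ} (hkl : k * Fintype.card F ≡ l [MOD orderOf χ])
    (hmn : m * Fintype.card F ≡ n [MOD orderOf χ]) :
    jacobiSum (χ ^ l) (χ ^ n) = jacobiSum (χ ^ k) (χ ^ m) := by
  rw [← jacobiSum_pow_card F (χ ^ k), ← pow_mul, ← pow_mul, pow_eq_pow_iff_modEq.mpr hkl,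
    pow_eq_pow_iff_modEq.mpr hmn]

theorem star_jacobiSum (χ ψ : MulChar K ℂ) : star (jacobiSum χ ψ) = jacobiSum χ⁻¹ ψ⁻¹ := by
  simp only [jacobiSum, star_sum, star_mul', MulChar.star_apply']

end JacobiSums

section Octic

variable {K : Type*} [Field K] [Fintype K] {χ : MulChar K ℂ}

theorem quinticCharSum_eq_sum_jacobiSum [DecidableEq K] (hK : ringChar K ≠ 2) (hχ : orderOf χ = 8) :
    (quinticCharSum K : ℂ) = jacobiSum χ (χ ^ 4) + jacobiSum (χ ^ 3) (χ ^ 4) +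
      jacobiSum (χ ^ 5) (χ ^ 4) + jacobiSum (χ ^ 7) (χ ^ 4) := by
  have hχ2 : orderOf (χ ^ 2) = 4 := by rw [orderOf_pow_of_dvd two_ne_zero] <;> simp [hχ]
  have hχ4 : orderOf (χ ^ 4) = 2 := by rw [orderOf_pow_of_dvd four_ne_zero] <;> simp [hχ]
  calc (quinticCharSum K : ℂ) = ∑ w : K, χ (w ^ 4) * (χ ^ 4) (1 - w ^ 4) := by
        simp only [quinticCharSum, Int.cast_sum, Int.cast_mul, map_pow,
          ← eq_quadraticChar_of_orderOf_eq_two hK hχ4, MulChar.pow_apply' χ four_ne_zero]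
    _ = _ := by
        rw [sum_comp_pow_four hK hχ2 fun y => χ y * (χ ^ 4) (1 - y)]
        simp only [jacobiSum, ← sum_add_distrib]
        refine sum_congr rfl fun y _ => ?_
        simp only [MulChar.pow_apply' χ, ne_eq, OfNat.ofNat_ne_zero, not_false_eq_true]
        ring

omit [Fintype K] in
theorem pow_ne_one_of_orderOf_eq_eight (hχ : orderOf χ = 8) {m : ℕ} (hm : m % 8 ≠ 0) :
    χ ^ m ≠ 1 := fun h => hm (Nat.mod_eq_zero_of_dvd (hχ ▸ orderOf_dvd_of_pow_eq_one h))

omit [Fintype K] in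
theorem inv_pow_eq_pow_of_orderOf_eq_eight (hχ : orderOf χ = 8) {m n : ℕ} (h : 8 ∣ n + m) :
    (χ ^ m)⁻¹ = χ ^ n := by
  rw [inv_eq_iff_mul_eq_one, ← pow_add, ← orderOf_dvd_iff_pow_eq_one, hχ, add_comm]
  exact h

theorem jacobiSum_pow_mul_jacobiSum_pow (hχ : orderOf χ = 8) {k l : ℕ} (hk : k % 4 ≠ 0)
    (hkl : 8 ∣ l + k) :
    jacobiSum (χ ^ k) (χ ^ 4) * jacobiSum (χ ^ l) (χ ^ 4) = Fintype.card K := by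
  have hchar : ringChar ℂ ≠ ringChar K := by
    rw [ringChar.eq_zero]
    exact (CharP.ringChar_ne_zero_of_finite K).symm
  have h := jacobiSum_mul_jacobiSum_inv hchar (χ := χ ^ k) (φ := χ ^ 4)
    (pow_ne_one_of_orderOf_eq_eight hχ (by omega)) (pow_ne_one_of_orderOf_eq_eight hχ (by omega))
    (by rw [← pow_add]; exact pow_ne_one_of_orderOf_eq_eight hχ (by omega))
  rwa [inv_pow_eq_pow_of_orderOf_eq_eight hχ hkl,
    inv_pow_eq_pow_of_orderOf_eq_eight hχ (by norm_num : 8 ∣ 4 + 4)] at h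

theorem jacobiSum_pow_eq_of_orderOf_eq_eight (F : Type*) [Field F] [Fintype F] [Algebra F K]
    (hχ : orderOf χ = 8) (hF : Fintype.card F % 2 = 1) {k l : ℕ}
    (hkl : k * Fintype.card F % 8 = l % 8) :
    jacobiSum (χ ^ l) (χ ^ 4) = jacobiSum (χ ^ k) (χ ^ 4) :=
  jacobiSum_pow_eq_of_modEq F (hχ ▸ hkl) (by rw [hχ, Nat.ModEq]; omega)

theorem quinticCharSum_of_card_mod_eight_eq_seven (F : Type*) [Field F] [Fintype F] [Algebra F K]
    [DecidableEq K] (hK : ringChar K ≠ 2) (hχ : orderOf χ = 8) (hF : Fintype.card F % 8 = 7)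
    (hcard : Fintype.card K = Fintype.card F ^ 2) :
    quinticCharSum K = 4 * Fintype.card F ∨ quinticCharSum K = 0 ∨
      quinticCharSum K = -(4 * Fintype.card F) := by
  have h71 : jacobiSum (χ ^ 7) (χ ^ 4) = jacobiSum (χ ^ 1) (χ ^ 4) :=
    jacobiSum_pow_eq_of_orderOf_eq_eight F hχ (by omega) (by omega)
  have h53 : jacobiSum (χ ^ 5) (χ ^ 4) = jacobiSum (χ ^ 3) (χ ^ 4) :=
    jacobiSum_pow_eq_of_orderOf_eq_eight F hχ (by omega) (by omega)
  have hJ1 := jacobiSum_pow_mul_jacobiSum_pow hχ (k := 1) (l := 7) (by norm_num) (by norm_num)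
  have hJ3 := jacobiSum_pow_mul_jacobiSum_pow hχ (k := 3) (l := 5) (by norm_num) (by norm_num)
  have hsum := quinticCharSum_eq_sum_jacobiSum hK hχ
  rw [h71, h53, pow_one] at hsum
  rw [h71, hcard, ← sq, Nat.cast_pow, sq_eq_sq_iff_eq_or_eq_neg, pow_one] at hJ1
  rw [h53, hcard, ← sq, Nat.cast_pow, sq_eq_sq_iff_eq_or_eq_neg] at hJ3
  have hcast {z : ℤ} (h : (quinticCharSum K : ℂ) = z) : quinticCharSum K = z := by exact_mod_cast h
  rcases hJ1 with hJ1 | hJ1 <;> rcases hJ3 with hJ3 | hJ3 <;> rw [hJ1, hJ3] at hsum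
  · exact .inl (hcast (by rw [hsum]; push_cast; ring))
  · exact .inr (.inl (hcast (by rw [hsum]; push_cast; ring)))
  · exact .inr (.inl (hcast (by rw [hsum]; push_cast; ring)))
  · exact .inr (.inr (hcast (by rw [hsum]; push_cast; ring)))

theorem exists_im_add_pow_three_eq_mul_sqrt_two {x : ℂ} (hx : x ^ 8 = 1) :
    ∃ b : ℤ, (x + x ^ 3).im = b * √2 := by
  have h4 : x ^ 4 = 1 ∨ x ^ 4 = -1 := sq_eq_one_iff.mp (by rw [← pow_mul, hx])
  rcases h4 with h4 | h4
  · have h2 : x ^ 2 = 1 ∨ x ^ 2 = -1 :=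
      sq_eq_one_iff.mp (by rw [← pow_mul, h4])
    refine ⟨0, ?_⟩
    rcases h2 with h2 | h2
    · rcases sq_eq_one_iff.mp h2 with rfl | rfl <;> norm_num
    · rw [show x + x ^ 3 = 0 by linear_combination x * h2]
      simp
  · have hsqrt : (√2 : ℂ) ^ 2 = 2 := by
      rw [← Complex.ofReal_pow, Real.sq_sqrt zero_le_two, Complex.ofReal_ofNat]
    have hsq : (x + x ^ 3) ^ 2 = (√2 * Complex.I) ^ 2 := by
      rw [mul_pow, Complex.I_sq, hsqrt]
      linear_combination (2 + x ^ 2) * h4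
    rcases sq_eq_sq_iff_eq_or_eq_neg.mp hsq with h | h <;> rw [h]
    · exact ⟨1, by simp⟩
    · exact ⟨-1, by simp⟩

theorem exists_im_jacobiSum_add_jacobiSum_pow_three (hK : ringChar K ≠ 2) (hχ : orderOf χ = 8) :
    ∃ B : ℤ, (jacobiSum χ (χ ^ 4) + jacobiSum (χ ^ 3) (χ ^ 4)).im = B * √2 := by
  classical
  have hχ4 : orderOf (χ ^ 4) = 2 := by rw [orderOf_pow_of_dvd four_ne_zero] <;> simp [hχ]
  have hvalue (y : K) : ∃ b : ℤ, (χ y + χ y ^ 3).im = b * √2 := by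
    rcases eq_or_ne y 0 with rfl | hy
    · exact ⟨0, by simp [MulChar.map_zero]⟩
    · refine exists_im_add_pow_three_eq_mul_sqrt_two ?_
      rw [← MulChar.pow_apply' χ (by norm_num), ← hχ, pow_orderOf_eq_one,
        MulChar.one_apply hy.isUnit]
  choose b hb using hvalue
  refine ⟨∑ y, b y * quadraticChar K (1 - y), ?_⟩
  simp only [jacobiSum, ← sum_add_distrib, ← add_mul, MulChar.pow_apply' χ three_ne_zero,
    eq_quadraticChar_of_orderOf_eq_two hK hχ4, Complex.im_sum, Int.cast_sum, Int.cast_mul, sum_mul]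
  refine sum_congr rfl fun y _ => ?_
  rw [← Complex.ofReal_intCast, Complex.im_mul_ofReal, hb]
  ring

theorem exists_card_sq_eq_sq_add_two_mul_sq (F : Type*) [Field F] [Fintype F] [Algebra F K]
    [DecidableEq K] (hK : ringChar K ≠ 2) (hχ : orderOf χ = 8) (hF : Fintype.card F % 8 = 3)
    (hcard : Fintype.card K = Fintype.card F ^ 2) {U : ℤ} (hU : quinticCharSum K = 4 * U) :
    ∃ V : ℤ, (Fintype.card F : ℤ) ^ 2 = U ^ 2 + 2 * V ^ 2 := by
  have h31 : jacobiSum (χ ^ 3) (χ ^ 4) = jacobiSum (χ ^ 1) (χ ^ 4) :=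
    jacobiSum_pow_eq_of_orderOf_eq_eight F hχ (by omega) (by omega)
  have h57 : jacobiSum (χ ^ 5) (χ ^ 4) = jacobiSum (χ ^ 7) (χ ^ 4) :=
    jacobiSum_pow_eq_of_orderOf_eq_eight F hχ (by omega) (by omega)
  have hconj : jacobiSum (χ ^ 7) (χ ^ 4) = star (jacobiSum χ (χ ^ 4)) := by
    rw [star_jacobiSum, inv_pow_eq_pow_of_orderOf_eq_eight hχ (by norm_num : 8 ∣ 4 + 4),
      ← inv_pow_eq_pow_of_orderOf_eq_eight hχ (by norm_num : 8 ∣ 7 + 1), pow_one]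
  have hnorm := jacobiSum_pow_mul_jacobiSum_pow hχ (k := 1) (l := 7) (by norm_num) (by norm_num)
  obtain ⟨B, hB⟩ := exists_im_jacobiSum_add_jacobiSum_pow_three hK hχ
  have hsum := quinticCharSum_eq_sum_jacobiSum hK hχ
  rw [pow_one] at h31
  rw [h31, Complex.add_im] at hB
  rw [pow_one, hconj, hcard, Complex.star_def, Complex.mul_conj] at hnorm
  rw [h57, h31, hconj, hU] at hsum
  generalize jacobiSum χ (χ ^ 4) = J at hB hnorm hsum
  have hre : J.re = U := by
    have h := congrArg Complex.re hsum
    simp only [Complex.star_def, Complex.add_re, Complex.conj_re, Complex.mul_re, Complex.re_ofNat,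
      Complex.im_ofNat, Complex.intCast_re, Complex.intCast_im, Int.cast_mul, Int.cast_ofNat] at h
    linarith
  have hnormSq : J.re ^ 2 + J.im ^ 2 = (Fintype.card F : ℝ) ^ 2 := by
    rw [Complex.normSq_apply] at hnorm
    rw [sq, sq J.im]
    exact_mod_cast hnorm
  have hB2 : 2 * (Fintype.card F : ℤ) ^ 2 = 2 * U ^ 2 + B ^ 2 := by
    have hreal : 2 * (Fintype.card F : ℝ) ^ 2 = 2 * U ^ 2 + B ^ 2 := by
      have hsqrt : √2 ^ 2 = (2 : ℝ) := Real.sq_sqrt zero_le_two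
      linear_combination -2 * hnormSq + 2 * (J.re + U) * hre + (J.im + B * √2 / 2) * hB +
        B ^ 2 / 2 * hsqrt
    exact_mod_cast hreal
  have hBeven : Even B :=
    (Int.even_pow' two_ne_zero).mp ⟨(Fintype.card F : ℤ) ^ 2 - U ^ 2, by linarith⟩
  obtain ⟨V, rfl⟩ := hBeven
  exact ⟨V, by linarith⟩

end Octic

section Generator

variable {K : Type*} [Field K] [Fintype K] {g : Kˣ}

theorem generator_pow_eq_one_iff (hg : ∀ x, x ∈ Subgroup.zpowers g) {m : ℕ} :
    (g : K) ^ m = 1 ↔ Fintype.card K - 1 ∣ m := by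
  rw [← Units.val_pow_eq_pow_val, Units.val_eq_one, ← orderOf_dvd_iff_pow_eq_one,
    orderOf_eq_card_of_forall_mem_zpowers hg, Nat.card_units, Nat.card_eq_fintype_card]

theorem generator_pow_card_div_two (hK : ringChar K ≠ 2) (hg : ∀ x, x ∈ Subgroup.zpowers g) :
    (g : K) ^ (Fintype.card K / 2) = -1 := by
  classical
  rw [← quadraticChar_eq_pow_of_char_ne_two' hK, quadraticChar_generator hK hg]
  norm_num

theorem sum_eq_sum_range_generator_pow {M : Type*} [AddCommMonoid M]
    (hg : ∀ x, x ∈ Subgroup.zpowers g) (f : K → M) (h0 : f 0 = 0) :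
    ∑ w, f w = ∑ j ∈ range (Fintype.card K - 1), f ((g : K) ^ j) := by
  classical
  have hord : orderOf g = Fintype.card K - 1 := by
    rw [orderOf_eq_card_of_forall_mem_zpowers hg, Nat.card_units, Nat.card_eq_fintype_card]
  rw [← sum_units_eq_sum f h0, ← IsCyclic.image_range_orderOf hg, hord, sum_image]
  · simp only [Units.val_pow_eq_pow_val]
  · rw [← hord, coe_range]
    exact pow_injOn_Iio_orderOf

theorem sum_range_four_mul_of_periodic {f : ℕ → ℤ} {m : ℕ} (hf : ∀ j, f (m + j) = f j) :
    ∑ j ∈ range (4 * m), f j = 4 * ∑ j ∈ range m, f j := by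
  rw [show 4 * m = m + (m + (m + m)) by ring]
  simp only [sum_range_add, hf]
  ring

theorem sum_range_two_mul_modEq_four {n : ℕ} (hn : n ≠ 0) {a : ℕ → ℤ} (h0 : a 0 = 0)
    (hsymm : ∀ i j, i + j = 2 * n → a i = a j) (hodd : ∀ j, 0 < j → j < n → Odd (a j)) :
    ∑ j ∈ range (2 * n), a j ≡ a n + 2 * (n - 1) [ZMOD 4] := by
  obtain ⟨m, rfl⟩ := Nat.exists_eq_add_one_of_ne_zero hn
  have hreflect : ∑ j ∈ range m, a (m + 1 + (j + 1)) = ∑ j ∈ range m, a (j + 1) := by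
    rw [← sum_range_reflect]
    refine sum_congr rfl fun j hj => hsymm _ _ ?_
    have := mem_range.mp hj
    omega
  have hsum : ∑ j ∈ range (2 * (m + 1)), a j = a (m + 1) + 2 * ∑ j ∈ range m, a (j + 1) := by
    rw [two_mul (m + 1), sum_range_add, sum_range_succ', sum_range_succ', hreflect, h0, add_zero,
      add_zero]
    ring
  have hmod : ∑ j ∈ range m, a (j + 1) ≡ ∑ _j ∈ range m, 1 [ZMOD 2] := by
    refine Int.ModEq.sum fun j hj => Int.odd_iff.mp (hodd (j + 1) j.succ_pos ?_)
    have := mem_range.mp hj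
    omega
  rw [hsum, Nat.cast_add_one, add_sub_cancel_right]
  simpa using (hmod.mul_left' (c := 2)).add_left (a (m + 1))

variable [DecidableEq K] {n : ℕ}

theorem quinticCharSum_eq_four_mul_sum_range (hcard : Fintype.card K = 8 * n + 1)
    (hg : ∀ x, x ∈ Subgroup.zpowers g) :
    quinticCharSum K =
      4 * ∑ j ∈ range (2 * n), (-1) ^ j * quadraticChar K (1 - (g : K) ^ (4 * j)) := by
  have hK : ringChar K ≠ 2 := ringChar_ne_two_of_odd_card ⟨4 * n, by omega⟩
  have hg1 : (g : K) ^ (4 * (2 * n)) = 1 :=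
    (generator_pow_eq_one_iff hg).mpr (by rw [hcard]; exact ⟨1, by omega⟩)
  rw [quinticCharSum, sum_eq_sum_range_generator_pow hg _ (by simp), hcard,
    show 8 * n + 1 - 1 = 4 * (2 * n) by omega]
  simp only [map_pow, quadraticChar_generator hK hg, ← pow_mul, mul_comm _ 4]
  refine sum_range_four_mul_of_periodic fun _ => ?_
  rw [mul_add 4, pow_add, pow_add, hg1, one_mul, (even_two_mul n).neg_one_pow, one_mul]

theorem quadraticChar_one_sub_sq_of_sq_mul_eq_one (hneg : quadraticChar K (-1) = 1) {x y : K}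
    (hxy : x ^ 2 * y = 1) : quadraticChar K (1 - x ^ 2) = quadraticChar K (1 - y) := by
  have hx : x ≠ 0 := by
    rintro rfl
    simp at hxy
  rw [show 1 - x ^ 2 = -1 * (x ^ 2 * (1 - y)) by linear_combination -hxy, map_mul, hneg, map_mul,
    quadraticChar_sq_one' hx, one_mul, one_mul]

theorem sum_range_generator_modEq_neg_one (hcard : Fintype.card K = 8 * n + 1)
    (hg : ∀ x, x ∈ Subgroup.zpowers g) :
    ∑ j ∈ range (2 * n), (-1) ^ j * quadraticChar K (1 - (g : K) ^ (4 * j)) ≡ -1 [ZMOD 4] := by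
  have hn : n ≠ 0 := by
    rintro rfl
    exact absurd (Fintype.one_lt_card (α := K)) (by omega)
  have hK : ringChar K ≠ 2 := ringChar_ne_two_of_odd_card ⟨4 * n, by omega⟩
  have hψneg : quadraticChar K (-1) = 1 :=
    (quadraticChar_one_iff_isSquare (neg_ne_zero.mpr one_ne_zero)).mpr
      (FiniteField.isSquare_neg_one_iff.mpr (by omega))
  have hψtwo : quadraticChar K 2 = 1 :=
    (quadraticChar_one_iff_isSquare (Ring.two_ne_zero hK)).mpr
      (FiniteField.isSquare_two_iff.mpr (by omega))
  have hsymm (i j : ℕ) (hij : i + j = 2 * n) :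
      (-1) ^ i * quadraticChar K (1 - (g : K) ^ (4 * i)) =
        (-1) ^ j * quadraticChar K (1 - (g : K) ^ (4 * j)) := by
    have hprod : ((g : K) ^ (2 * i)) ^ 2 * (g : K) ^ (4 * j) = 1 := by
      rw [← pow_mul, ← pow_add, generator_pow_eq_one_iff hg, hcard]
      exact ⟨1, by omega⟩
    have hsign : (-1 : ℤ) ^ i = (-1) ^ j := neg_one_pow_congr (Nat.even_add.mp ⟨n, by omega⟩)
    rw [hsign, ← quadraticChar_one_sub_sq_of_sq_mul_eq_one hψneg hprod, ← pow_mul]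
    ring_nf
  have hodd (j : ℕ) (hj : 0 < j) (hjn : j < n) :
      Odd ((-1) ^ j * quadraticChar K (1 - (g : K) ^ (4 * j))) := by
    have hne : 1 - (g : K) ^ (4 * j) ≠ 0 := fun h => by
      have hdvd := (generator_pow_eq_one_iff hg).mp (sub_eq_zero.mp h).symm
      have := Nat.le_of_dvd (by omega) hdvd
      omega
    refine odd_neg_one.pow.mul ?_
    rcases quadraticChar_dichotomy hne with h | h <;> rw [h] <;> decide
  refine (sum_range_two_mul_modEq_four hn (by simp) hsymm hodd).trans ?_
  have hhalf : (g : K) ^ (4 * n) = -1 := by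
    rw [← generator_pow_card_div_two hK hg]
    congr 1
    omega
  rw [hhalf, show (1 : K) - -1 = 2 by ring, hψtwo, mul_one, Int.ModEq]
  rcases Nat.even_or_odd n with h | h <;> rw [h.neg_one_pow] <;> obtain ⟨k, rfl⟩ := h <;>
    push_cast <;> omega

theorem exists_quinticCharSum_eq_four_mul (hcard : Fintype.card K = 8 * n + 1) :
    ∃ U : ℤ, quinticCharSum K = 4 * U ∧ U ≡ -1 [ZMOD 4] := by
  obtain ⟨g, hg⟩ := IsCyclic.exists_generator (α := Kˣ)
  exact ⟨_, quinticCharSum_eq_four_mul_sum_range hcard hg,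
    sum_range_generator_modEq_neg_one hcard hg⟩

end Generator

section NotDvd

variable {K : Type*} [Field K] [Fintype K] {n : ℕ}

theorem sum_pow_eq_ite {i : ℕ} (hi : i ≠ 0) :
    ∑ w : K, w ^ i = if Fintype.card K - 1 ∣ i then -1 else 0 := by
  classical
  rw [← FiniteField.sum_pow_units, ← sum_units_eq_sum (fun w : K => w ^ i) (zero_pow hi)]

theorem filter_range_eight_mul_dvd (hn : n ≠ 0) :
    {k ∈ range (4 * n + 1) | 8 * n ∣ 4 * n + 4 * k} = {n, 3 * n} := by
  ext k
  simp only [mem_filter, mem_range, mem_insert, mem_singleton]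
  constructor
  · rintro ⟨hk, m, hm⟩
    have hm3 : m < 3 := by
      by_contra! h
      have := Nat.mul_le_mul_left (8 * n) h
      omega
    interval_cases m <;> omega
  · rintro (rfl | rfl)
    · exact ⟨by omega, 1, by ring⟩
    · exact ⟨by omega, 2, by ring⟩

theorem sum_pow_mul_one_sub_pow (hcard : Fintype.card K = 8 * n + 1) :
    ∑ w : K, w ^ (4 * n) * (1 - w ^ 4) ^ (4 * n) = -2 * (-1) ^ n * ((4 * n).choose n : K) := by
  have hn : n ≠ 0 := by
    rintro rfl
    exact absurd (Fintype.one_lt_card (α := K)) (by omega)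
  have hbinomial (w : K) : w ^ (4 * n) * (1 - w ^ 4) ^ (4 * n) =
      ∑ k ∈ range (4 * n + 1), ((-1) ^ k * ((4 * n).choose k : K)) * w ^ (4 * n + 4 * k) := by
    rw [sub_eq_add_neg, add_comm, add_pow, mul_sum]
    refine sum_congr rfl fun k _ => ?_
    rw [neg_pow, one_pow, ← pow_mul, pow_add]
    ring
  have hpow (k : ℕ) :
      ∑ w : K, w ^ (4 * n + 4 * k) = if 8 * n ∣ 4 * n + 4 * k then -1 else 0 := by
    rw [sum_pow_eq_ite (by omega), hcard, Nat.add_sub_cancel]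
  have hchoose : (4 * n).choose (3 * n) = (4 * n).choose n :=
    Nat.choose_symm_of_eq_add (by omega)
  simp_rw [hbinomial]
  rw [sum_comm]
  simp_rw [← mul_sum, hpow, mul_ite, mul_zero]
  rw [← sum_filter, filter_range_eight_mul_dvd hn, sum_pair (by omega), hchoose, pow_mul (-1) 3]
  norm_num
  ring

theorem not_dvd_of_quinticCharSum_eq_four_mul [DecidableEq K] {p : ℕ} [CharP K p]
    (hcard : Fintype.card K = 8 * n + 1) (hp : ¬ p ∣ (4 * n).choose n) {U : ℤ}
    (hU : quinticCharSum K = 4 * U) : ¬ (p : ℤ) ∣ U := by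
  intro hdvd
  have hK : ringChar K ≠ 2 := ringChar_ne_two_of_odd_card ⟨4 * n, by omega⟩
  have hsum : -2 * (-1) ^ n * ((4 * n).choose n : K) = 4 * (U : K) := by
    rw [← sum_pow_mul_one_sub_pow hcard, ← Int.cast_ofNat, ← Int.cast_mul, ← hU, quinticCharSum,
      Int.cast_sum]
    simp only [Int.cast_mul, quadraticChar_eq_pow_of_char_ne_two' hK,
      show Fintype.card K / 2 = 4 * n by omega]
  rw [(CharP.intCast_eq_zero_iff K p U).mpr hdvd, mul_zero] at hsum
  have htwo : (-2 : K) ≠ 0 := neg_ne_zero.mpr (Ring.two_ne_zero hK)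
  have hchoose : ((4 * n).choose n : K) ≠ 0 := mt (CharP.cast_eq_zero_iff K p _).mp hp
  exact mul_ne_zero (mul_ne_zero htwo (pow_ne_zero _ (neg_ne_zero.mpr one_ne_zero))) hchoose hsum

theorem not_dvd_choose_mul_add {p N M c d : ℕ} (hp : p.Prime) (hc : c < p) (hd : d ≤ c)
    (h : ¬ p ∣ N.choose M) : ¬ p ∣ (p * N + c).choose (p * M + d) := by
  have : Fact p.Prime := ⟨hp⟩
  have hdp : d < p := hd.trans_lt hc
  have hlucas : (p * N + c).choose (p * M + d) ≡ c.choose d * N.choose M [MOD p] := by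
    simpa only [Nat.mul_add_mod, Nat.mod_eq_of_lt hc, Nat.mod_eq_of_lt hdp,
      Nat.mul_add_div hp.pos, Nat.div_eq_of_lt hc, Nat.div_eq_of_lt hdp, add_zero] using
      Choose.choose_modEq_choose_mod_mul_choose_div_nat (p := p) (n := p * N + c) (k := p * M + d)
  rw [hlucas.dvd_iff dvd_rfl, hp.dvd_mul, not_or]
  exact ⟨hp.coprime_iff_not_dvd.mp (hp.coprime_choose_of_lt hc hd), h⟩

/-- For `p = 8l + 3` the base `p` digits of `n = (p ^ (2r) - 1) / 8` alternate between `3l + 1` and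
`l`, and all the digits of `4n` are `4l + 1`. -/
theorem exists_sq_eq_and_not_dvd_choose {p : ℕ} (hp : p.Prime) (hp8 : p % 8 = 3) (r : ℕ) :
    ∃ n, (p ^ r) ^ 2 = 8 * n + 1 ∧ ¬ p ∣ (4 * n).choose n := by
  induction r with
  | zero => exact ⟨0, by simp, by simpa using hp.ne_one⟩
  | succ r ih =>
    obtain ⟨n, hn, hdvd⟩ := ih
    obtain ⟨l, hl⟩ : ∃ l, p = 8 * l + 3 := ⟨p / 8, by omega⟩
    refine ⟨p * (p * n + l) + (3 * l + 1), ?_, ?_⟩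
    · rw [pow_succ p r, mul_pow, hn, hl]
      ring
    · have hdigits : 4 * (p * (p * n + l) + (3 * l + 1)) =
          p * (p * (4 * n) + (4 * l + 1)) + (4 * l + 1) := by
        rw [hl]
        ring
      rw [hdigits]
      exact not_dvd_choose_mul_add hp (by omega) (by omega)
        (not_dvd_choose_mul_add hp (by omega) (by omega) hdvd)

end NotDvd

section QuadraticForms

theorem sq_eq_sq_of_dvd {N d u v u' v' : ℤ} (hN : N ≠ 0) (hd : 2 ≤ d) (h : N = u ^ 2 + d * v ^ 2)
    (h' : N = u' ^ 2 + d * v' ^ 2) (hdvd : N ∣ u * v' - u' * v) : u ^ 2 = u' ^ 2 := by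
  obtain ⟨t, ht⟩ := hdvd
  have hN2 : 0 < N ^ 2 := by positivity
  -- Brahmagupta's identity
  have hmul : N ^ 2 = (u * u' + d * v * v') ^ 2 + d * (N * t) ^ 2 := by
    rw [← ht]
    linear_combination N * h + (u ^ 2 + d * v ^ 2) * h'
  have ht0 : t = 0 := by
    by_contra hne
    have ht1 : 1 ≤ t ^ 2 := Int.add_one_le_iff.mpr (sq_pos_iff.mpr hne)
    nlinarith [sq_nonneg (u * u' + d * v * v'), mul_le_mul hd ht1 zero_le_one (by linarith)]
  rw [ht0, mul_zero] at ht
  refine sub_eq_zero.mp ((mul_eq_zero.mp ?_).resolve_left hN)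
  linear_combination u ^ 2 * h' - u' ^ 2 * h + d * (u * v' + u' * v) * ht

theorem sq_eq_sq_of_prime_pow_eq {p d u v u' v' : ℤ} {m : ℕ} (hp : Prime p) (hp2 : ¬ p ∣ 2)
    (hd : 2 ≤ d) (h : p ^ m = u ^ 2 + d * v ^ 2) (h' : p ^ m = u' ^ 2 + d * v' ^ 2)
    (hu : ¬ p ∣ u) (hu' : ¬ p ∣ u') : u ^ 2 = u' ^ 2 := by
  have hN : p ^ m ≠ 0 := pow_ne_zero m hp.ne_zero
  rcases eq_or_ne m 0 with rfl | hm
  · exact sq_eq_sq_of_dvd hN hd h h' (by simp)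
  have hprod : p ^ m ∣ (u * v' - u' * v) * (u * v' + u' * v) :=
    ⟨v' ^ 2 - v ^ 2, by linear_combination v ^ 2 * h' - v' ^ 2 * h⟩
  by_cases hsub : p ∣ u * v' - u' * v
  · have hadd : ¬ p ∣ u * v' + u' * v := fun hadd => by
      have hdvd : p ∣ 2 * (u * v') := (dvd_add hsub hadd).trans (dvd_of_eq (by ring))
      have hv' : p ∣ v' :=
        (hp.dvd_or_dvd ((hp.dvd_or_dvd hdvd).resolve_left hp2)).resolve_left hu
      refine hu' (hp.dvd_of_dvd_pow (n := 2) ?_)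
      rw [eq_sub_of_add_eq h'.symm]
      exact dvd_sub (dvd_pow_self p hm) ((dvd_pow hv' two_ne_zero).mul_left d)
    exact sq_eq_sq_of_dvd hN hd h h' (hp.pow_dvd_of_dvd_mul_right m hadd hprod)
  · refine sq_eq_sq_of_dvd (v' := -v') hN hd h (by rwa [neg_sq]) ?_
    rw [show u * -v' - u' * v = -(u * v' + u' * v) by ring]
    exact (hp.pow_dvd_of_dvd_mul_left m hsub hprod).neg_right

theorem existsUnique_natAbs_of_prime_pow_eq {p m d : ℕ} (hp : Prime (p : ℤ))
    (hp2 : ¬ (p : ℤ) ∣ 2) (hm : m ≠ 0) (hd : 2 ≤ d) {u v : ℤ}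
    (h : (p : ℤ) ^ m = u ^ 2 + d * v ^ 2) (hu : ¬ (p : ℤ) ∣ u) :
    ∃! w : ℕ × ℕ, 0 < w.1 ∧ 0 < w.2 ∧ ¬ p ∣ w.1 ∧ p ^ m = w.1 ^ 2 + d * w.2 ^ 2 := by
  have hd' : (2 : ℤ) ≤ d := by exact_mod_cast hd
  have hu0 : u ≠ 0 := fun h0 => hu (h0 ▸ dvd_zero _)
  have hv0 : v ≠ 0 := by
    rintro rfl
    refine hu (hp.dvd_of_dvd_pow (n := 2) ?_)
    rw [← add_zero (u ^ 2), ← mul_zero (d : ℤ), ← zero_pow two_ne_zero, ← h]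
    exact dvd_pow_self _ hm
  refine ⟨(u.natAbs, v.natAbs), ⟨Int.natAbs_pos.mpr hu0, Int.natAbs_pos.mpr hv0, ?_, ?_⟩, ?_⟩
  · rwa [← Int.natCast_dvd]
  · zify
    rwa [sq_abs, sq_abs]
  · rintro ⟨a, b⟩ ⟨-, -, ha, hab⟩
    have hab' : (p : ℤ) ^ m = (a : ℤ) ^ 2 + d * (b : ℤ) ^ 2 := by exact_mod_cast hab
    have ha2 : (a : ℤ) ^ 2 = u ^ 2 :=
      sq_eq_sq_of_prime_pow_eq hp hp2 hd' hab' h (by exact_mod_cast ha) hu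
    have hb2 : (b : ℤ) ^ 2 = v ^ 2 :=
      mul_left_cancel₀ (by positivity : (d : ℤ) ≠ 0) (by linarith)
    rw [← Int.natAbs_natCast a, ← Int.natAbs_natCast b, Int.natAbs_eq_iff_sq_eq.mpr ha2,
      Int.natAbs_eq_iff_sq_eq.mpr hb2]

theorem exists_sq_of_isCoprime_of_nonneg {s t W : ℤ} (hst : IsCoprime s t) (h : s * t = W ^ 2)
    (hs : 0 ≤ s) : ∃ A, s = A ^ 2 := by
  obtain ⟨A, hA | hA⟩ := Int.sq_of_isCoprime hst h
  · exact ⟨A, hA⟩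
  · exact ⟨A, by linarith [sq_nonneg A]⟩

theorem exists_sq_add_two_mul_sq_of_sq_eq {q U V : ℤ} (hq : 0 ≤ q) (hqU : q ≡ U [ZMOD 4])
    (hcop : IsCoprime q U) (h : q ^ 2 = U ^ 2 + 2 * V ^ 2) :
    ∃ A B : ℤ, q = A ^ 2 + 2 * B ^ 2 ∧ U = A ^ 2 - 2 * B ^ 2 := by
  obtain ⟨t, ht⟩ := hqU.symm.dvd
  obtain ⟨s, rfl⟩ : ∃ s, q = s + 2 * t := ⟨q - 2 * t, by ring⟩
  obtain rfl : U = s - 2 * t := by linarith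
  have hV : V ^ 2 = 2 * (2 * (s * t)) := by linarith
  obtain ⟨W, rfl⟩ : Even V := (Int.even_pow' two_ne_zero).mp (hV ▸ even_two_mul _)
  have hst : s * t = W ^ 2 := by linarith
  have hcop' : IsCoprime s t := by
    obtain ⟨x, y, hxy⟩ := hcop
    exact ⟨x + y, 2 * (x - y), by linear_combination hxy⟩
  have hst0 : 0 ≤ s * t := hst ▸ sq_nonneg W
  have hs : 0 ≤ s := by nlinarith [hst0]
  have ht' : 0 ≤ t := by nlinarith [hst0]
  obtain ⟨A, hA⟩ := exists_sq_of_isCoprime_of_nonneg hcop' hst hs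
  obtain ⟨B, hB⟩ := exists_sq_of_isCoprime_of_nonneg hcop'.symm (mul_comm s t ▸ hst) ht'
  exact ⟨A, B, by rw [hA, hB], by rw [hA, hB]⟩

theorem sq_sub_two_mul_sq_modEq_neg_one {A B : ℤ} (h : A ^ 2 + 2 * B ^ 2 ≡ 3 [ZMOD 8]) :
    A ^ 2 - 2 * B ^ 2 ≡ -1 [ZMOD 8] := by
  have hsq (x : ℤ) : x ^ 2 % 8 = 0 ∨ x ^ 2 % 8 = 1 ∨ x ^ 2 % 8 = 4 := by
    rw [sq, Int.mul_emod]
    have hx : 0 ≤ x % 8 ∧ x % 8 < 8 := by omega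
    generalize x % 8 = r at hx ⊢
    obtain ⟨hr0, hr8⟩ := hx
    interval_cases r <;> decide
  have hA := hsq A
  have hB := hsq B
  rw [Int.ModEq] at h ⊢
  omega

theorem not_dvd_sq_sub_mul_sq {p a b d : ℤ} (hp : Prime p) (hp2 : ¬ p ∣ 2) (ha : ¬ p ∣ a)
    (h : p ∣ a ^ 2 + d * b ^ 2) : ¬ p ∣ a ^ 2 - d * b ^ 2 := fun h' => by
  have hdvd : p ∣ 2 * a ^ 2 := (dvd_add h h').trans (dvd_of_eq (by ring))
  exact ha (hp.dvd_of_dvd_pow ((hp.dvd_or_dvd hdvd).resolve_left hp2))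

theorem not_dvd_of_prime_eq_sq_add_mul_sq {p d a b : ℤ} (hp : Prime p) (hd : ¬ p ∣ d)
    (h : p = a ^ 2 + d * b ^ 2) : ¬ p ∣ a := by
  intro ha
  have hdb : p ∣ d * b ^ 2 := by
    rw [← sub_eq_of_eq_add' h]
    exact dvd_sub_self_left.mpr (dvd_pow ha two_ne_zero)
  obtain ⟨b', rfl⟩ := hp.dvd_of_dvd_pow ((hp.dvd_or_dvd hdb).resolve_left hd)
  obtain ⟨a', rfl⟩ := ha
  refine hp.not_dvd_one ⟨a' ^ 2 + d * b' ^ 2, mul_left_cancel₀ hp.ne_zero ?_⟩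
  linear_combination h

theorem not_intCast_dvd_two_of_mod_eight {p : ℕ} (hp8 : p % 8 = 3) : ¬ (p : ℤ) ∣ 2 := fun h => by
  have := Int.le_of_dvd two_pos h
  omega

theorem mod_eight_eq_three_of_pow_mod_eight_eq_three {p r : ℕ} (h : p ^ r % 8 = 3) :
    p % 8 = 3 := by
  have hr : r ≠ 0 := by
    rintro rfl
    simp at h
  have hodd : Odd p := (Nat.odd_pow_iff hr).mp (Nat.odd_iff.mpr (by omega))
  have hsq : p ^ 2 ≡ 1 [MOD 8] :=
    ((Nat.modEq_iff_dvd' hodd.pow.pos).mpr (Nat.eight_dvd_sq_sub_one_of_odd hodd)).symm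
  obtain ⟨k, rfl | rfl⟩ := Nat.even_or_odd' r
  · have h1 : p ^ (2 * k) ≡ 1 [MOD 8] := by
      simpa only [pow_mul, one_pow] using hsq.pow k
    rw [Nat.ModEq] at h1
    omega
  · have hp : p ^ (2 * k + 1) ≡ p [MOD 8] := by
      simpa only [pow_succ, pow_mul, one_pow, one_mul] using (hsq.pow k).mul_right p
    rw [Nat.ModEq] at hp
    omega

end QuadraticForms

section QuadraticDoubleSum

variable {F : Type*} [Field F] [Fintype F]

theorem exists_mulChar_orderOf_eq_eight {K : Type*} [Field K] [Fintype K] {n : ℕ}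
    (hcard : Fintype.card K = 8 * n + 1) : ∃ χ : MulChar K ℂ, orderOf χ = 8 :=
  MulChar.exists_mulChar_orderOf K ⟨n, by omega⟩ (Complex.isPrimitiveRoot_exp 8 (by norm_num))

theorem quadraticDoubleSum_of_card_mod_eight_eq_seven [DecidableEq F]
    (hF : Fintype.card F % 8 = 7) : quadraticDoubleSum F = 2 * (Fintype.card F : ℤ) := by
  classical
  have hF4 : Fintype.card F % 4 = 3 := by omega
  have := GaussExt.fact_of_card_mod_four hF4
  have hK : ringChar (GaussExt F) ≠ 2 := by
    rw [← Algebra.ringChar_eq F]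
    exact ringChar_ne_two_of_odd_card (Nat.odd_iff.mpr (by omega))
  obtain ⟨n, hn⟩ : 8 ∣ Fintype.card F ^ 2 - 1 :=
    Nat.eight_dvd_sq_sub_one_of_odd (Nat.odd_iff.mpr (by omega))
  have hcard : Fintype.card (GaussExt F) = 8 * n + 1 := by
    have := Nat.one_le_pow 2 _ (Fintype.card_pos (α := F))
    rw [GaussExt.card_eq_sq]
    omega
  obtain ⟨χ, hχ⟩ := exists_mulChar_orderOf_eq_eight hcard
  obtain ⟨U, hU, hU4⟩ := exists_quinticCharSum_eq_four_mul hcard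
  have hcases := quinticCharSum_of_card_mod_eight_eq_seven F hK hχ hF (GaussExt.card_eq_sq F)
  rw [GaussExt.quinticCharSum_eq_two_mul_quadraticDoubleSum hF4] at hcases hU
  rw [Int.ModEq] at hU4
  omega

theorem exists_card_eq_prime_pow (p : ℕ) [CharP F p] (hF : Fintype.card F % 8 = 3) :
    ∃ r, r ≠ 0 ∧ p.Prime ∧ p % 8 = 3 ∧ Fintype.card F = p ^ r := by
  obtain ⟨r, hp, hcard⟩ := FiniteField.card F p
  exact ⟨r, r.ne_zero, hp, mod_eight_eq_three_of_pow_mod_eight_eq_three (hcard ▸ hF), hcard⟩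

theorem exists_sq_add_two_mul_sq_and_quadraticDoubleSum_eq [DecidableEq F] (p : ℕ) [CharP F p]
    (hF : Fintype.card F % 8 = 3) :
    ∃ A B : ℤ, (Fintype.card F : ℤ) = A ^ 2 + 2 * B ^ 2 ∧ ¬ (p : ℤ) ∣ A ^ 2 - 2 * B ^ 2 ∧
      quadraticDoubleSum F = 2 * (A ^ 2 - 2 * B ^ 2) := by
  classical
  obtain ⟨r, -, hp, hp8, hcardF⟩ := exists_card_eq_prime_pow p hF
  have hF4 : Fintype.card F % 4 = 3 := by omega
  have := GaussExt.fact_of_card_mod_four hF4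
  have : CharP (GaussExt F) p :=
    charP_of_injective_algebraMap (algebraMap F (GaussExt F)).injective p
  have hK : ringChar (GaussExt F) ≠ 2 := by
    rw [← Algebra.ringChar_eq F]
    exact ringChar_ne_two_of_odd_card (Nat.odd_iff.mpr (by omega))
  obtain ⟨n, hn, hchoose⟩ := exists_sq_eq_and_not_dvd_choose hp hp8 r
  have hcard : Fintype.card (GaussExt F) = 8 * n + 1 := by rw [GaussExt.card_eq_sq, hcardF, hn]
  obtain ⟨χ, hχ⟩ := exists_mulChar_orderOf_eq_eight hcard
  obtain ⟨U, hU, hU4⟩ := exists_quinticCharSum_eq_four_mul hcard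
  obtain ⟨V, hV⟩ := exists_card_sq_eq_sq_add_two_mul_sq F hK hχ hF (GaussExt.card_eq_sq F) hU
  have hpU : ¬ (p : ℤ) ∣ U := not_dvd_of_quinticCharSum_eq_four_mul hcard hchoose hU
  have hcop : IsCoprime (Fintype.card F : ℤ) U := by
    rw [hcardF, Nat.cast_pow]
    exact ((Nat.prime_iff_prime_int.mp hp).coprime_iff_not_dvd.mpr hpU).pow_left
  have hFU : (Fintype.card F : ℤ) ≡ U [ZMOD 4] := by
    rw [Int.ModEq] at hU4 ⊢
    omega
  obtain ⟨A, B, hA, rfl⟩ := exists_sq_add_two_mul_sq_of_sq_eq (by positivity) hFU hcop hV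
  rw [GaussExt.quinticCharSum_eq_two_mul_quadraticDoubleSum hF4] at hU
  exact ⟨A, B, hA, hpU, by linarith⟩

theorem eq_of_card_sq_eq_of_modEq (p : ℕ) [CharP F p] (hF : Fintype.card F % 8 = 3)
    {u v u' v' : ℤ} (h : (Fintype.card F : ℤ) ^ 2 = u ^ 2 + 2 * v ^ 2)
    (h' : (Fintype.card F : ℤ) ^ 2 = u' ^ 2 + 2 * v' ^ 2) (hu : ¬ (p : ℤ) ∣ u)
    (hu' : ¬ (p : ℤ) ∣ u') (hu8 : u ≡ -1 [ZMOD 8]) (hu8' : u' ≡ -1 [ZMOD 8]) : u = u' := by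
  obtain ⟨r, -, hp, hp8, hcard⟩ := exists_card_eq_prime_pow p hF
  rw [hcard, Nat.cast_pow, ← pow_mul] at h h'
  have hsq : u ^ 2 = u' ^ 2 :=
    sq_eq_sq_of_prime_pow_eq (Nat.prime_iff_prime_int.mp hp) (not_intCast_dvd_two_of_mod_eight hp8)
      le_rfl h h' hu hu'
  refine (sq_eq_sq_iff_eq_or_eq_neg.mp hsq).resolve_right fun hneg => ?_
  rw [Int.ModEq] at hu8 hu8'
  omega

theorem exists_card_sq_eq_and_quadraticDoubleSum_eq [DecidableEq F] (p : ℕ) [CharP F p]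
    (hF : Fintype.card F % 8 = 3) :
    ∃ u v : ℤ, (Fintype.card F : ℤ) ^ 2 = u ^ 2 + 2 * v ^ 2 ∧ ¬ (p : ℤ) ∣ u ∧
      u ≡ -1 [ZMOD 8] ∧ quadraticDoubleSum F = 2 * u := by
  obtain ⟨A, B, hcard, hp, hsum⟩ := exists_sq_add_two_mul_sq_and_quadraticDoubleSum_eq p hF
  refine ⟨A ^ 2 - 2 * B ^ 2, 2 * A * B, by rw [hcard]; ring, hp, ?_, hsum⟩
  refine sq_sub_two_mul_sq_modEq_neg_one ?_
  rw [← hcard, Int.ModEq]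
  omega

theorem existsUnique_pos_card_sq_eq (p : ℕ) [CharP F p] (hF : Fintype.card F % 8 = 3) :
    ∃! w : ℕ × ℕ, 0 < w.1 ∧ 0 < w.2 ∧ ¬ p ∣ w.1 ∧
      Fintype.card F ^ 2 = w.1 ^ 2 + 2 * w.2 ^ 2 := by
  classical
  obtain ⟨u, v, huv, hu, -⟩ := exists_card_sq_eq_and_quadraticDoubleSum_eq p hF
  obtain ⟨r, hr, hp, hp8, hcard⟩ := exists_card_eq_prime_pow p hF
  rw [hcard, Nat.cast_pow, ← pow_mul] at huv
  rw [hcard, ← pow_mul]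
  exact existsUnique_natAbs_of_prime_pow_eq (Nat.prime_iff_prime_int.mp hp)
    (not_intCast_dvd_two_of_mod_eight hp8) (mul_ne_zero hr two_ne_zero) le_rfl huv hu

theorem existsUnique_modEq_card_sq_eq (p : ℕ) [CharP F p] (hF : Fintype.card F % 8 = 3) :
    ∃! u : ℤ, (∃ v : ℤ, (Fintype.card F : ℤ) ^ 2 = u ^ 2 + 2 * v ^ 2) ∧ ¬ (p : ℤ) ∣ u ∧
      u ≡ -1 [ZMOD 8] := by
  classical
  obtain ⟨u, v, huv, hu, hu8, -⟩ := exists_card_sq_eq_and_quadraticDoubleSum_eq p hF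
  refine ⟨u, ⟨⟨v, huv⟩, hu, hu8⟩, ?_⟩
  rintro u' ⟨⟨v', huv'⟩, hu', hu8'⟩
  exact eq_of_card_sq_eq_of_modEq p hF huv' huv hu' hu hu8' hu8

theorem quadraticDoubleSum_eq_two_mul [DecidableEq F] (p : ℕ) [CharP F p]
    (hF : Fintype.card F % 8 = 3) {u v : ℤ}
    (huv : (Fintype.card F : ℤ) ^ 2 = u ^ 2 + 2 * v ^ 2) (hu : ¬ (p : ℤ) ∣ u)
    (hu8 : u ≡ -1 [ZMOD 8]) : quadraticDoubleSum F = 2 * u := by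
  obtain ⟨u', v', huv', hu', hu8', hsum⟩ := exists_card_sq_eq_and_quadraticDoubleSum_eq p hF
  rw [hsum, eq_of_card_sq_eq_of_modEq p hF huv huv' hu hu' hu8 hu8']

theorem quadraticDoubleSum_eq_of_card_eq_sq_add_two_mul_sq [DecidableEq F] (p : ℕ) [CharP F p]
    (hF : Fintype.card F % 8 = 3) {a b : ℤ} (hab : (Fintype.card F : ℤ) = a ^ 2 + 2 * b ^ 2)
    (ha : ¬ (p : ℤ) ∣ a) : quadraticDoubleSum F = 4 * a ^ 2 - 2 * (Fintype.card F : ℤ) := by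
  obtain ⟨r, hr, hp, hp8, hcard⟩ := exists_card_eq_prime_pow p hF
  have hdvd : (p : ℤ) ∣ a ^ 2 + 2 * b ^ 2 := by
    rw [← hab, hcard, Nat.cast_pow]
    exact dvd_pow_self _ hr
  have hu8 : a ^ 2 - 2 * b ^ 2 ≡ -1 [ZMOD 8] := by
    refine sq_sub_two_mul_sq_modEq_neg_one ?_
    rw [← hab, Int.ModEq]
    omega
  have hu : ¬ (p : ℤ) ∣ a ^ 2 - 2 * b ^ 2 :=
    not_dvd_sq_sub_mul_sq (Nat.prime_iff_prime_int.mp hp) (not_intCast_dvd_two_of_mod_eight hp8)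
      ha hdvd
  rw [quadraticDoubleSum_eq_two_mul p hF (v := 2 * a * b) (by rw [hab]; ring) hu hu8]
  linarith

end QuadraticDoubleSum

theorem theorem5p5 {F : Type*} [Field F] [Fintype F] [DecidableEq F] (p q : ℕ) [CharP F p]
    (hq : Fintype.card F = q) :
    (q ≡ 7 [MOD 8] → quadraticDoubleSum F = 2 * (q : ℤ)) ∧
    (q ≡ 3 [MOD 8] →
      (∃! w : ℕ × ℕ, 0 < w.1 ∧ 0 < w.2 ∧ ¬ p ∣ w.1 ∧ q ^ 2 = w.1 ^ 2 + 2 * w.2 ^ 2) ∧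
      (∃! u : ℤ, (∃ v : ℤ, (q : ℤ) ^ 2 = u ^ 2 + 2 * v ^ 2) ∧ ¬ (p : ℤ) ∣ u ∧
        u ≡ -1 [ZMOD 8]) ∧
      (∀ u v : ℤ, (q : ℤ) ^ 2 = u ^ 2 + 2 * v ^ 2 → ¬ (p : ℤ) ∣ u → u ≡ -1 [ZMOD 8] →
        quadraticDoubleSum F = 2 * u)) ∧
    (q = p → q ≡ 3 [MOD 8] →
      (∃ a b : ℤ, (p : ℤ) = a ^ 2 + 2 * b ^ 2) ∧
      (∀ a b : ℤ, (p : ℤ) = a ^ 2 + 2 * b ^ 2 →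
        quadraticDoubleSum F = 4 * a ^ 2 - 2 * (p : ℤ))) := by
  subst hq
  refine ⟨quadraticDoubleSum_of_card_mod_eight_eq_seven,
    fun h3 => ⟨existsUnique_pos_card_sq_eq p h3, existsUnique_modEq_card_sq_eq p h3,
      fun u v => quadraticDoubleSum_eq_two_mul p h3⟩,
    fun hcard h3 => ?_⟩
  obtain ⟨r, -, hp, hp8, -⟩ := exists_card_eq_prime_pow p h3
  rw [← hcard]
  refine ⟨?_, fun a b hab => ?_⟩
  · obtain ⟨A, B, hAB, -⟩ := exists_sq_add_two_mul_sq_and_quadraticDoubleSum_eq p h3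
    exact ⟨A, B, hAB⟩
  · refine quadraticDoubleSum_eq_of_card_eq_sq_add_two_mul_sq p h3 hab ?_
    exact not_dvd_of_prime_eq_sq_add_mul_sq (Nat.prime_iff_prime_int.mp hp)
      (not_intCast_dvd_two_of_mod_eight hp8) (hcard ▸ hab)
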